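/- Let $(\gamma_{i,j})_{i,j\ge 1}$ be real numbers and $A>0$ a constant such that, for all $i,j\ge 1$, $$0\le \gamma_{i,j}=\gamma_{j,i},\qquad \gamma_{i,j}\le A(i+j).$$ Let $\Xi_1$ be the space of real sequences $x=(x_i)_{i\ge1}$ with $\|x\|_{\Xi_1}:=\sum_{i=1}^\infty i|x_i|<\infty$, and $\Xi_1^+=\{x\in\Xi_1: x_i\ge 0 \text{ for all } i\ge 1\}$. Let $\xi^{in}=(\xi^{in}_i)_{i\ge1}\in\Xi_1^+$. Then the discrete Safronov–Dubovskiĭ equation $$\frac{d\xi_i}{dt}=\xi_{i-1}\sum_{j=1}^{i-1} j\gamma_{i-1,j}\xi_j-\xi_i\sum_{j=1}^{i} j\gamma_{i,j}\xi_j-\sum_{j=i}^{\infty}\gamma_{i,j}\xi_i\xi_j,\qquad \xi_i(0)=\xi_i^{in},\qquad i\ge 1$$ (the first term being $0$ for $i=1$) has at least one global weak solution that conserves mass. That is, there are nonnegative continuous functions $\xi_i:[0,\infty)\to[0,\infty)$, $i\ge1$, such that for all $i\ge 1$ and $t\ge 0$ the series $\sum_{j=i}^\infty\gamma_{i,j}\xi_i\xi_j$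 converges almost everywhere on $(0,t)$ and its sum belongs to $L^1(0,t)$, $$\xi_i(t)=\xi_i^{in}+\int_0^t\Big[\xi_{i-1}(\tau)\sum_{j=1}^{i-1} j\gamma_{i-1,j}\xi_j(\tau)-\xi_i(\tau)\sum_{j=1}^{i} j\gamma_{i,j}\xi_j(\tau)-\sum_{j=i}^{\infty}\gamma_{i,j}\xi_i(\tau)\xi_j(\tau)\Big]\,d\tau ,$$ and, for every $t\ge 0$, $\xi(t)=(\xi_i(t))_{i\ge1}\in\Xi_1^+$ with $$\|\xi(t)\|_{\Xi_1}=\|\xi^{in}\|_{\Xi_1}.$$ -/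

import Mathlib

open MeasureTheory

/-!
The discrete Safronov-Dubovskii coagulation equation

  `dξ_i/dt = ξ_{i-1} ∑_{j=1}^{i-1} j γ_{i-1,j} ξ_j - ξ_i ∑_{j=1}^{i} j γ_{i,j} ξ_j
               - ∑_{j=i}^{∞} γ_{i,j} ξ_i ξ_j`,   `i ≥ 1`.

A sequence indexed by the integers `i ≥ 1` is represented by a function on `ℕ` whose value at `0`
is never used; a sum over all `j ≥ i` is written as a sum over `k : ℕ` with `j = i + k`.
-/

namespace SafronovDubovskii

/-- The space `Ξ_l` of real sequences `(x_i)_{i ≥ 1}` with `∑_{i ≥ 1} i ^ l * |x_i| < ∞`. -/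
def Xi (l : ℝ) : Set (ℕ → ℝ) :=
  {x | Summable fun k : ℕ => ((1 + k : ℕ) : ℝ) ^ l * |x (1 + k)|}

/-- The norm `‖x‖_l = ∑_{i ≥ 1} i ^ l * |x_i|` of `x ∈ Ξ_l`. -/
noncomputable def xiNorm (l : ℝ) (x : ℕ → ℝ) : ℝ :=
  ∑' k : ℕ, ((1 + k : ℕ) : ℝ) ^ l * |x (1 + k)|

/-- The positive cone `Ξ_l^+` of `Ξ_l`. -/
def XiPlus (l : ℝ) : Set (ℕ → ℝ) :=
  {x | x ∈ Xi l ∧ ∀ i : ℕ, 1 ≤ i → 0 ≤ x i}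

/-- The right-hand side of the `i`-th equation (`i ≥ 1`), at the state `x = (x_j)_{j ≥ 1}`.
For `i = 1` the first sum is empty, so the first term is zero. -/
noncomputable def rhs (γ : ℕ → ℕ → ℝ) (x : ℕ → ℝ) (i : ℕ) : ℝ :=
  x (i - 1) * ∑ j ∈ Finset.Icc 1 (i - 1), (j : ℝ) * γ (i - 1) j * x j
    - x i * ∑ j ∈ Finset.Icc 1 i, (j : ℝ) * γ i j * x j
    - ∑' k : ℕ, γ i (i + k) * x i * x (i + k)

/-- The time interval `[0, T)`, where `T = ⊤` is allowed and gives `[0, ∞)`. -/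
def timeInterval (T : EReal) : Set ℝ :=
  {t | 0 ≤ t ∧ (t : EReal) < T}

/-- `ξ = (ξ_i)_{i ≥ 1}` is a (weak) solution on `[0, T)` with initial datum `ξin`: a sequence of
nonnegative continuous functions on `[0, T)` such that, for all `i ≥ 1` and `t ∈ [0, T)`, the
series `∑_{j ≥ i} γ_{i,j} ξ_i ξ_j` converges almost everywhere on `(0, t)` to an integrable
function, and the time-integrated equation holds. -/
structure IsSolution (γ : ℕ → ℕ → ℝ) (ξin : ℕ → ℝ) (T : EReal) (ξ : ℕ → ℝ → ℝ) : Prop where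
  nonneg : ∀ i : ℕ, 1 ≤ i → ∀ t ∈ timeInterval T, 0 ≤ ξ i t
  continuousOn : ∀ i : ℕ, 1 ≤ i → ContinuousOn (ξ i) (timeInterval T)
  ae_summable : ∀ i : ℕ, 1 ≤ i → ∀ t ∈ timeInterval T,
    ∀ᵐ τ ∂(volume.restrict (Set.Ioo 0 t)), Summable fun k : ℕ => γ i (i + k) * ξ i τ * ξ (i + k) τ
  integrableOn : ∀ i : ℕ, 1 ≤ i → ∀ t ∈ timeInterval T,
    IntegrableOn (fun τ : ℝ => ∑' k : ℕ, γ i (i + k) * ξ i τ * ξ (i + k) τ) (Set.Ioo 0 t) volume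
  integral_eq : ∀ i : ℕ, 1 ≤ i → ∀ t ∈ timeInterval T,
    ξ i t = ξin i + ∫ τ in (0 : ℝ)..t, rhs γ (fun j => ξ j τ) i

end SafronovDubovskii

namespace SafronovDubovskii

/-! The solution is a limit of explicit Euler polygons for finite truncations. If the kernel is cut
off to indices in `[1, n)`, the system is finite, and testing the flux with φ produces the factor
j(φ(i+1) − φ(i)) − φ(j) over pairs j ≤ i. For φ(i) = i this vanishes, so every Euler step preserves
mass exactly, and small enough steps preserve nonnegativity. Mass and linear growth of the kernel
then bound each component and its flux independently of n (`abs_flux_le`), and a diagonal argument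
extracts a subsequence converging at every time (`exists_subseq_tendsto`).

The danger is mass escaping to infinity. It is excluded by weights φ = min(i, i²/m): they satisfy
i(φ(i+1) − φ(i)) ≤ 3φ(i), so a discrete Gronwall argument bounds the φ-moment at time t by exp(6AMt)
times its initial value, where M is the initial mass (`moment_eulerSeq_le`). The initial value tends
to 0 as m → ∞ because the datum has finite mass, and φ(i) = i for i ≥ m, so the mass tails are small
uniformly in n (`uniform_tail_of_tailWeight`). No higher moment of the datum is needed. Uniform
tails let limits pass through the infinite loss sum and the total mass
(`tendsto_sum_of_uniform_tail`). -/

/-- The rate at which clusters of size `i` are turned into clusters of size `i + 1`. -/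
noncomputable def growthRate (N : ℕ) (c : ℕ → ℕ → ℝ) (x : ℕ → ℝ) (i : ℕ) : ℝ :=
  x i * ∑ j ∈ Finset.range N, if j ≤ i then (j : ℝ) * c i j * x j else 0

/-- The rate at which clusters of size `i` are fragmented into monomers. -/
noncomputable def lossRate (N : ℕ) (c : ℕ → ℕ → ℝ) (x : ℕ → ℝ) (i : ℕ) : ℝ :=
  x i * ∑ j ∈ Finset.range N, if i ≤ j then c i j * x j else 0

/-- The right-hand side of the system with interactions restricted to indices below `N`. -/
noncomputable def flux (N : ℕ) (c : ℕ → ℕ → ℝ) (x : ℕ → ℝ) (i : ℕ) : ℝ :=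
  growthRate N c x (i - 1) - growthRate N c x i - lossRate N c x i

/-- The explicit Euler scheme with step `h` for the vector field `flux N c`. -/
noncomputable def eulerSeq (N : ℕ) (c : ℕ → ℕ → ℝ) (h : ℝ) (x₀ : ℕ → ℝ) : ℕ → ℕ → ℝ
  | 0 => x₀
  | k + 1 => fun i => eulerSeq N c h x₀ k i + h * flux N c (eulerSeq N c h x₀ k) i

/-- A symmetric nonnegative kernel of linear growth which vanishes unless both indices lie in
`[1, n)`. -/
structure IsCutoffKernel (A : ℝ) (n : ℕ) (c : ℕ → ℕ → ℝ) : Prop where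
  nonneg : ∀ i j, 0 ≤ c i j
  symm : ∀ i j, c i j = c j i
  le : ∀ i j, c i j ≤ A * ((i : ℝ) + j)
  eq_zero : ∀ i j, i = 0 ∨ n ≤ i → c i j = 0

/-! ### A priori estimates for the truncated vector field -/

section Flux

variable {A M : ℝ} {n : ℕ} {c : ℕ → ℕ → ℝ} {x : ℕ → ℝ}

theorem growthRate_eq_zero {N : ℕ} (hc : IsCutoffKernel A n c) {i : ℕ} (hi : i = 0 ∨ n ≤ i) :
    growthRate N c x i = 0 := by
  simp [growthRate, hc.eq_zero i _ hi]

theorem lossRate_eq_zero {N : ℕ} (hc : IsCutoffKernel A n c) {i : ℕ} (hi : i = 0 ∨ n ≤ i) :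
    lossRate N c x i = 0 := by
  simp [lossRate, hc.eq_zero i _ hi]

theorem flux_eq_zero {N : ℕ} (hc : IsCutoffKernel A n c) {i : ℕ} (hi : i = 0 ∨ n < i) :
    flux N c x i = 0 := by
  rw [flux, growthRate_eq_zero hc (by omega), growthRate_eq_zero hc (by omega),
    lossRate_eq_zero hc (by omega)]
  simp

/-- The weak formulation of the truncated system. -/
theorem sum_mul_flux (hc : IsCutoffKernel A n c) (φ : ℕ → ℝ) :
    ∑ i ∈ Finset.range (n + 1), φ i * flux (n + 1) c x i =
      ∑ i ∈ Finset.range (n + 1), ∑ j ∈ Finset.range (n + 1),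
        if j ≤ i then (j * (φ (i + 1) - φ i) - φ j) * (c i j * x i * x j) else 0 := by
  have h1 : ∑ i ∈ Finset.range (n + 1), φ i * growthRate (n + 1) c x (i - 1) =
      ∑ i ∈ Finset.range (n + 1), φ (i + 1) * growthRate (n + 1) c x i := by
    -- Shifting the index costs no boundary term: the kernel already vanishes at index n, so nothing
    -- grows from n to n + 1.
    rw [Finset.sum_range_succ', Finset.sum_range_succ _ n,
      growthRate_eq_zero hc (Or.inr le_rfl), growthRate_eq_zero hc (Or.inl rfl)]
    simp
  have h2 : ∑ i ∈ Finset.range (n + 1), φ i * lossRate (n + 1) c x i =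
      ∑ i ∈ Finset.range (n + 1), ∑ j ∈ Finset.range (n + 1),
        if j ≤ i then φ j * (c i j * x i * x j) else 0 := by
    rw [Finset.sum_comm]
    refine Finset.sum_congr rfl fun i _ => ?_
    rw [lossRate, Finset.mul_sum, Finset.mul_sum]
    refine Finset.sum_congr rfl fun j _ => ?_
    rw [hc.symm i j]
    split_ifs <;> ring
  have h3 : ∑ i ∈ Finset.range (n + 1), φ i * flux (n + 1) c x i =
      ∑ i ∈ Finset.range (n + 1), φ i * growthRate (n + 1) c x (i - 1)
      - ∑ i ∈ Finset.range (n + 1), φ i * growthRate (n + 1) c x i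
      - ∑ i ∈ Finset.range (n + 1), φ i * lossRate (n + 1) c x i := by
    rw [← Finset.sum_sub_distrib, ← Finset.sum_sub_distrib]
    exact Finset.sum_congr rfl fun i _ => by rw [flux]; ring
  rw [h3, h1, h2, ← Finset.sum_sub_distrib, ← Finset.sum_sub_distrib]
  refine Finset.sum_congr rfl fun i _ => ?_
  rw [growthRate, Finset.mul_sum, Finset.mul_sum, Finset.mul_sum, ← Finset.sum_sub_distrib,
    ← Finset.sum_sub_distrib]
  refine Finset.sum_congr rfl fun j _ => ?_
  split_ifs <;> ring

/-- For φ(i) = i the factor in the weak form is j · 1 − j = 0. -/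
theorem sum_id_mul_flux (hc : IsCutoffKernel A n c) :
    ∑ i ∈ Finset.range (n + 1), (i : ℝ) * flux (n + 1) c x i = 0 := by
  rw [sum_mul_flux hc (fun i => (i : ℝ))]
  refine Finset.sum_eq_zero fun i _ => Finset.sum_eq_zero fun j _ => ?_
  push_cast
  split_ifs <;> ring

/-- Dropping −φ(j) and using `c i j` ≤ 2Ai for j ≤ i leaves 2Aj · i(φ(i+1) − φ(i)) ≤ 6Ajφ(i), whose
double sum factorises into mass times φ-moment. The resulting bound is linear in the moment, as
Gronwall requires. -/
theorem sum_mul_flux_le (hA : 0 ≤ A) (hc : IsCutoffKernel A n c) (hx : ∀ i, 0 ≤ x i)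
    (hM : ∑ i ∈ Finset.range (n + 1), (i : ℝ) * x i ≤ M) {φ : ℕ → ℝ} (hφ : ∀ i, 0 ≤ φ i)
    (hmono : Monotone φ) (hφ3 : ∀ i : ℕ, i * (φ (i + 1) - φ i) ≤ 3 * φ i) :
    ∑ i ∈ Finset.range (n + 1), φ i * flux (n + 1) c x i ≤
      6 * A * M * ∑ i ∈ Finset.range (n + 1), φ i * x i := by
  rw [sum_mul_flux hc]
  calc _ ≤ ∑ i ∈ Finset.range (n + 1), ∑ j ∈ Finset.range (n + 1),
        6 * A * (φ i * x i) * (j * x j) := by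
        refine Finset.sum_le_sum fun i _ => Finset.sum_le_sum fun j _ => ?_
        have hxx : 0 ≤ x i * x j := mul_nonneg (hx i) (hx j)
        split_ifs with hji
        · have hji' : (j : ℝ) ≤ i := by exact_mod_cast hji
          have hd : 0 ≤ φ (i + 1) - φ i := sub_nonneg.2 (hmono (Nat.le_succ i))
          have h1 : c i j ≤ 2 * A * i := by nlinarith [hc.le i j]
          have h2 : (j * (φ (i + 1) - φ i) - φ j) * c i j ≤ 6 * A * φ i * j := by
            calc (j * (φ (i + 1) - φ i) - φ j) * c i j
                ≤ (j * (φ (i + 1) - φ i)) * c i j := by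
                  have := mul_nonneg (hφ j) (hc.nonneg i j)
                  linarith
              _ ≤ (j * (φ (i + 1) - φ i)) * (2 * A * i) := by gcongr
              _ = 2 * A * j * (i * (φ (i + 1) - φ i)) := by ring
              _ ≤ 2 * A * j * (3 * φ i) := mul_le_mul_of_nonneg_left (hφ3 i) (by positivity)
              _ = _ := by ring
          calc _ = (j * (φ (i + 1) - φ i) - φ j) * c i j * (x i * x j) := by ring
            _ ≤ 6 * A * φ i * j * (x i * x j) := by gcongr
            _ = _ := by ring
        · have := hφ i
          have := hx i
          have := hx j
          positivity
    _ = 6 * A * (∑ i ∈ Finset.range (n + 1), (i : ℝ) * x i) *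
          ∑ i ∈ Finset.range (n + 1), φ i * x i := by
        simp_rw [← Finset.mul_sum, ← Finset.sum_mul]
        rw [← Finset.mul_sum]
        ring
    _ ≤ _ := by
        have : 0 ≤ ∑ i ∈ Finset.range (n + 1), φ i * x i :=
          Finset.sum_nonneg fun i _ => mul_nonneg (hφ i) (hx i)
        gcongr

theorem growth_factor_bounds (hA : 0 ≤ A) (hc : IsCutoffKernel A n c) (hx : ∀ i, 0 ≤ x i)
    (hM : ∑ i ∈ Finset.range (n + 1), (i : ℝ) * x i ≤ M) (i : ℕ) :
    0 ≤ (∑ j ∈ Finset.range (n + 1), if j ≤ i then (j : ℝ) * c i j * x j else 0) ∧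
      (∑ j ∈ Finset.range (n + 1), if j ≤ i then (j : ℝ) * c i j * x j else 0) ≤
        2 * A * i * M := by
  constructor
  · refine Finset.sum_nonneg fun j _ => ?_
    have := hx j
    have := hc.nonneg i j
    positivity
  · calc _ ≤ ∑ j ∈ Finset.range (n + 1), 2 * A * i * ((j : ℝ) * x j) := by
          refine Finset.sum_le_sum fun j _ => ?_
          have := hx j
          split_ifs with hji
          · have hji' : (j : ℝ) ≤ i := by exact_mod_cast hji
            have h1 : c i j ≤ 2 * A * i := by nlinarith [hc.le i j]
            calc (j : ℝ) * c i j * x j ≤ j * (2 * A * i) * x j := by gcongr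
              _ = _ := by ring
          · positivity
      _ = 2 * A * i * ∑ i ∈ Finset.range (n + 1), (i : ℝ) * x i := by rw [Finset.mul_sum]
      _ ≤ _ := by gcongr

/-- Since i ≤ j in this sum, `c i j` ≤ 2Aj, so the mass alone controls it, uniformly in i and n. -/
theorem loss_factor_bounds (hA : 0 ≤ A) (hc : IsCutoffKernel A n c) (hx : ∀ i, 0 ≤ x i)
    (hM : ∑ i ∈ Finset.range (n + 1), (i : ℝ) * x i ≤ M) (i : ℕ) :
    0 ≤ (∑ j ∈ Finset.range (n + 1), if i ≤ j then c i j * x j else 0) ∧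
      (∑ j ∈ Finset.range (n + 1), if i ≤ j then c i j * x j else 0) ≤ 2 * A * M := by
  constructor
  · refine Finset.sum_nonneg fun j _ => ?_
    have := mul_nonneg (hc.nonneg i j) (hx j)
    positivity
  · calc _ ≤ ∑ j ∈ Finset.range (n + 1), 2 * A * ((j : ℝ) * x j) := by
          refine Finset.sum_le_sum fun j _ => ?_
          have := hx j
          split_ifs with hij
          · have hij' : (i : ℝ) ≤ j := by exact_mod_cast hij
            have h1 : c i j ≤ 2 * A * j := by nlinarith [hc.le i j]
            calc c i j * x j ≤ (2 * A * j) * x j := by gcongr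
              _ = _ := by ring
          · positivity
      _ = 2 * A * ∑ i ∈ Finset.range (n + 1), (i : ℝ) * x i := by rw [Finset.mul_sum]
      _ ≤ _ := by gcongr

theorem le_mass (hx : ∀ i, 0 ≤ x i) (hx0 : ∀ i, i = 0 ∨ n < i → x i = 0)
    (hM : ∑ i ∈ Finset.range (n + 1), (i : ℝ) * x i ≤ M) (i : ℕ) : x i ≤ M := by
  have hnn : ∀ j ∈ Finset.range (n + 1), 0 ≤ (j : ℝ) * x j := fun j _ =>
    mul_nonneg (Nat.cast_nonneg j) (hx j)
  by_cases hi : i = 0 ∨ n < i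
  · rw [hx0 i hi]
    exact (Finset.sum_nonneg hnn).trans hM
  · push Not at hi
    have h1 : (1 : ℝ) ≤ i := by exact_mod_cast Nat.one_le_iff_ne_zero.2 hi.1
    have h2 := Finset.single_le_sum hnn (Finset.mem_range.2 (Nat.lt_succ_of_le hi.2))
    nlinarith [hx i]

theorem abs_flux_le (hA : 0 ≤ A) (hc : IsCutoffKernel A n c) (hx : ∀ i, 0 ≤ x i)
    (hx0 : ∀ i, i = 0 ∨ n < i → x i = 0)
    (hM : ∑ i ∈ Finset.range (n + 1), (i : ℝ) * x i ≤ M) (i : ℕ) :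
    |flux (n + 1) c x i| ≤ (4 * i + 2) * A * M ^ 2 := by
  have hle := le_mass hx hx0 hM
  have hM0 : 0 ≤ M := (hx 0).trans (hle 0)
  have hg : ∀ i, 0 ≤ growthRate (n + 1) c x i ∧ growthRate (n + 1) c x i ≤ 2 * A * i * M ^ 2 := by
    intro i
    obtain ⟨h1, h2⟩ := growth_factor_bounds hA hc hx hM i
    refine ⟨mul_nonneg (hx i) h1, ?_⟩
    calc growthRate (n + 1) c x i ≤ M * (2 * A * i * M) := mul_le_mul (hle i) h2 h1 hM0
      _ = _ := by ring
  have hl : 0 ≤ lossRate (n + 1) c x i ∧ lossRate (n + 1) c x i ≤ 2 * A * M ^ 2 := by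
    obtain ⟨h1, h2⟩ := loss_factor_bounds hA hc hx hM i
    refine ⟨mul_nonneg (hx i) h1, ?_⟩
    calc lossRate (n + 1) c x i ≤ M * (2 * A * M) := mul_le_mul (hle i) h2 h1 hM0
      _ = _ := by ring
  have h3 : 2 * A * ((i - 1 : ℕ) : ℝ) * M ^ 2 ≤ 2 * A * i * M ^ 2 := by
    gcongr
    omega
  have h4 : 0 ≤ A * M ^ 2 := by positivity
  have h5 : 0 ≤ 2 * A * i * M ^ 2 := by positivity
  obtain ⟨h6, h7⟩ := hg (i - 1)
  obtain ⟨h8, h9⟩ := hg i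
  rw [flux, abs_le]
  constructor <;> nlinarith

/-- Both negative terms of the flux carry the factor `x i`, so the new value is at least x(i)(1 −
h(a + b)); the step condition makes h(a + b) ≤ 1. -/
theorem add_mul_flux_nonneg (hA : 0 ≤ A) (hc : IsCutoffKernel A n c) (hx : ∀ i, 0 ≤ x i)
    (hM : ∑ i ∈ Finset.range (n + 1), (i : ℝ) * x i ≤ M) {h : ℝ} (h0 : 0 ≤ h)
    (hh : h * (2 * A * (n + 1) * M) ≤ 1) (i : ℕ) : 0 ≤ x i + h * flux (n + 1) c x i := by
  have hM0 : 0 ≤ M := le_trans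
    (Finset.sum_nonneg fun j _ => mul_nonneg (Nat.cast_nonneg j) (hx j)) hM
  by_cases hi : i = 0 ∨ n < i
  · simpa [flux_eq_zero hc hi] using hx i
  push Not at hi
  obtain ⟨h1, h2⟩ := growth_factor_bounds hA hc hx hM i
  obtain ⟨h3, h4⟩ := loss_factor_bounds hA hc hx hM i
  have h5 : 0 ≤ growthRate (n + 1) c x (i - 1) :=
    mul_nonneg (hx _) (growth_factor_bounds hA hc hx hM (i - 1)).1
  have h6 : 2 * A * i * M ≤ 2 * A * n * M := by gcongr; exact hi.2
  rw [flux, growthRate.eq_1 _ _ _ i, lossRate]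
  set a := ∑ j ∈ Finset.range (n + 1), if j ≤ i then (j : ℝ) * c i j * x j else 0
  set b := ∑ j ∈ Finset.range (n + 1), if i ≤ j then c i j * x j else 0
  have h7 : h * (a + b) ≤ 1 := by
    refine le_trans ?_ hh
    gcongr
    linarith
  nlinarith [mul_nonneg h0 h5, mul_nonneg (hx i) (sub_nonneg.2 h7)]

end Flux

/-! ### Invariants and moments of the Euler scheme -/

section Euler

variable {A M h : ℝ} {n : ℕ} {c : ℕ → ℕ → ℝ} {x₀ : ℕ → ℝ}

theorem eulerSeq_eq_zero (hc : IsCutoffKernel A n c) (hx0 : ∀ i, i = 0 ∨ n < i → x₀ i = 0)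
    (k : ℕ) : ∀ i, i = 0 ∨ n < i → eulerSeq (n + 1) c h x₀ k i = 0 := by
  induction k with
  | zero => exact hx0
  | succ k ih =>
    intro i hi
    simp [eulerSeq, ih i hi, flux_eq_zero hc hi]

theorem sum_mul_eulerSeq_succ (φ : ℕ → ℝ) (k : ℕ) :
    ∑ i ∈ Finset.range (n + 1), φ i * eulerSeq (n + 1) c h x₀ (k + 1) i =
      ∑ i ∈ Finset.range (n + 1), φ i * eulerSeq (n + 1) c h x₀ k i +
        h * ∑ i ∈ Finset.range (n + 1), φ i * flux (n + 1) c (eulerSeq (n + 1) c h x₀ k) i := by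
  rw [Finset.mul_sum, ← Finset.sum_add_distrib]
  exact Finset.sum_congr rfl fun i _ => by rw [eulerSeq]; ring

theorem mass_eulerSeq (hc : IsCutoffKernel A n c) (k : ℕ) :
    ∑ i ∈ Finset.range (n + 1), (i : ℝ) * eulerSeq (n + 1) c h x₀ k i =
      ∑ i ∈ Finset.range (n + 1), (i : ℝ) * x₀ i := by
  induction k with
  | zero => rfl
  | succ k ih =>
    rw [sum_mul_eulerSeq_succ (fun i => (i : ℝ)), sum_id_mul_flux hc, ih, mul_zero, add_zero]

theorem eulerSeq_nonneg (hA : 0 ≤ A) (hc : IsCutoffKernel A n c) (hx : ∀ i, 0 ≤ x₀ i)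
    (hM : ∑ i ∈ Finset.range (n + 1), (i : ℝ) * x₀ i ≤ M) (h0 : 0 ≤ h)
    (hh : h * (2 * A * (n + 1) * M) ≤ 1) (k : ℕ) : ∀ i, 0 ≤ eulerSeq (n + 1) c h x₀ k i := by
  induction k with
  | zero => exact hx
  | succ k ih => exact add_mul_flux_nonneg hA hc ih ((mass_eulerSeq hc k).trans_le hM) h0 hh

/-- Discrete Gronwall: each step multiplies the moment by at most 1 + 6AMh ≤ exp(6AMh). -/
theorem moment_eulerSeq_le (hA : 0 ≤ A) (hc : IsCutoffKernel A n c) (hx : ∀ i, 0 ≤ x₀ i)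
    (hM : ∑ i ∈ Finset.range (n + 1), (i : ℝ) * x₀ i ≤ M) (h0 : 0 ≤ h)
    (hh : h * (2 * A * (n + 1) * M) ≤ 1) {φ : ℕ → ℝ} (hφ : ∀ i, 0 ≤ φ i)
    (hmono : Monotone φ) (hφ3 : ∀ i : ℕ, i * (φ (i + 1) - φ i) ≤ 3 * φ i) (k : ℕ) :
    ∑ i ∈ Finset.range (n + 1), φ i * eulerSeq (n + 1) c h x₀ k i ≤
      Real.exp (6 * A * M * (k * h)) * ∑ i ∈ Finset.range (n + 1), φ i * x₀ i := by
  have hM0 : 0 ≤ M := le_trans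
    (Finset.sum_nonneg fun j _ => mul_nonneg (Nat.cast_nonneg j) (hx j)) hM
  induction k with
  | zero => simp [eulerSeq]
  | succ k ih =>
    have h1 := sum_mul_flux_le hA hc (eulerSeq_nonneg hA hc hx hM h0 hh k)
      ((mass_eulerSeq hc k).trans_le hM) hφ hmono hφ3
    have h2 : 0 ≤ ∑ i ∈ Finset.range (n + 1), φ i * eulerSeq (n + 1) c h x₀ k i :=
      Finset.sum_nonneg fun i _ => mul_nonneg (hφ i) (eulerSeq_nonneg hA hc hx hM h0 hh k i)
    rw [sum_mul_eulerSeq_succ]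
    set S := ∑ i ∈ Finset.range (n + 1), φ i * eulerSeq (n + 1) c h x₀ k i
    have h3 : 6 * A * M * h + 1 ≤ Real.exp (6 * A * M * h) := Real.add_one_le_exp _
    calc _ ≤ S + h * (6 * A * M * S) := by gcongr
      _ = (6 * A * M * h + 1) * S := by ring
      _ ≤ Real.exp (6 * A * M * h) * S := by gcongr
      _ ≤ Real.exp (6 * A * M * h) * (Real.exp (6 * A * M * (k * h)) *
          ∑ i ∈ Finset.range (n + 1), φ i * x₀ i) := by gcongr
      _ = _ := by
        rw [← mul_assoc, ← Real.exp_add]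
        push_cast
        ring_nf

end Euler

/-! ### Weights detecting the mass tail -/

/-- The weight `min(i, i² / m)`, which is at least `i` for `i ≥ m` and tends to `0` as `m → ∞`. -/
noncomputable def tailWeight (m i : ℕ) : ℝ := min (i : ℝ) ((i : ℝ) ^ 2 / m)

theorem tailWeight_nonneg (m i : ℕ) : 0 ≤ tailWeight m i := by
  rw [tailWeight]; positivity

theorem tailWeight_le (m i : ℕ) : tailWeight m i ≤ i := min_le_left _ _

theorem monotone_tailWeight (m : ℕ) : Monotone (tailWeight m) := by
  intro i j hij
  rw [tailWeight, tailWeight]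
  gcongr

theorem tailWeight_eq {m i : ℕ} (hm : 0 < m) (hi : m ≤ i) : tailWeight m i = i := by
  have hm' : (0 : ℝ) < m := by exact_mod_cast hm
  have hi' : (m : ℝ) ≤ i := by exact_mod_cast hi
  rw [tailWeight, min_eq_left]
  rw [le_div_iff₀ hm']
  nlinarith

/-- In the quadratic range the increment is at most (2i + 1)/m, and i(2i + 1) ≤ 3i² on integers; in
the linear range it is 1. -/
theorem mul_tailWeight_succ_sub_le {m : ℕ} (hm : 0 < m) (i : ℕ) :
    i * (tailWeight m (i + 1) - tailWeight m i) ≤ 3 * tailWeight m i := by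
  have hm' : (0 : ℝ) < m := by exact_mod_cast hm
  rcases le_total m i with hi | hi
  · rw [tailWeight_eq hm hi, tailWeight_eq hm (by omega)]
    push_cast
    nlinarith [(Nat.cast_nonneg i : (0 : ℝ) ≤ i)]
  · have hi' : (i : ℝ) ≤ m := by exact_mod_cast hi
    have h1 : tailWeight m i = (i : ℝ) ^ 2 / m := by
      rw [tailWeight, min_eq_right]
      rw [div_le_iff₀ hm']
      nlinarith [(Nat.cast_nonneg i : (0 : ℝ) ≤ i)]
    have h2 : tailWeight m (i + 1) ≤ ((i : ℝ) + 1) ^ 2 / m := by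
      rw [tailWeight]
      push_cast
      exact min_le_right _ _
    have h3 : (i : ℝ) ≤ (i : ℝ) ^ 2 := by exact_mod_cast Nat.le_self_pow two_ne_zero i
    calc i * (tailWeight m (i + 1) - tailWeight m i)
        ≤ i * (((i : ℝ) + 1) ^ 2 / m - (i : ℝ) ^ 2 / m) := by rw [h1]; gcongr
      _ = (2 * (i : ℝ) ^ 2 + i) / m * 1 := by field_simp; ring
      _ ≤ (3 * (i : ℝ) ^ 2) / m * 1 := by gcongr; linarith
      _ = _ := by rw [h1]; ring

/-- Dominated convergence: for fixed i the weight is at most i²/m → 0, and i · y(i) dominates. -/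
theorem tendsto_tsum_tailWeight {y : ℕ → ℝ} (hy : ∀ i, 0 ≤ y i)
    (hs : Summable fun i : ℕ => (i : ℝ) * y i) :
    Filter.Tendsto (fun m => ∑' i, tailWeight m i * y i) Filter.atTop (nhds 0) := by
  have h := tendsto_tsum_of_dominated_convergence (𝓕 := Filter.atTop)
    (f := fun m i => tailWeight m i * y i) (g := fun _ => 0) hs (fun i => ?_)
    (Filter.Eventually.of_forall fun m i => ?_)
  · simpa using h
  · have h1 : Filter.Tendsto (fun m : ℕ => (i : ℝ) ^ 2 / m * y i) Filter.atTop (nhds 0) := by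
      simpa using (tendsto_const_div_atTop_nhds_zero_nat ((i : ℝ) ^ 2)).mul_const (y i)
    refine squeeze_zero (fun m => mul_nonneg (tailWeight_nonneg m i) (hy i)) (fun m => ?_) h1
    exact mul_le_mul_of_nonneg_right (min_le_right _ _) (hy i)
  · rw [Real.norm_of_nonneg (mul_nonneg (tailWeight_nonneg m i) (hy i))]
    exact mul_le_mul_of_nonneg_right (tailWeight_le m i) (hy i)

/-! ### Compactness and exchange of limit and sum -/

open Filter Topology

/-- The head converges termwise, while the tails of the approximants, and hence of the limit, are
uniformly small. -/
theorem tendsto_sum_of_uniform_tail {a : ℕ → ℕ → ℝ} {b : ℕ → ℝ} {N : ℕ → ℕ}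
    (hN : Tendsto N atTop atTop) (ha : ∀ n j, 0 ≤ a n j)
    (hab : ∀ j, Tendsto (fun n => a n j) atTop (𝓝 (b j)))
    (htail : ∀ ε > 0, ∃ m, ∀ n k, ∑ j ∈ Finset.Ico m k, a n j ≤ ε) :
    Summable b ∧ Tendsto (fun n => ∑ j ∈ Finset.range (N n), a n j) atTop (𝓝 (∑' j, b j)) := by
  have hb : ∀ j, 0 ≤ b j := fun j => ge_of_tendsto' (hab j) fun n => ha n j
  have hbtail : ∀ ε > 0, ∃ m, ∀ k, ∑ j ∈ Finset.Ico m k, b j ≤ ε := fun ε hε => by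
    obtain ⟨m, hm⟩ := htail ε hε
    exact ⟨m, fun k => le_of_tendsto' (tendsto_finsetSum _ fun j _ => hab j) fun n => hm n k⟩
  have hsplit : ∀ (f : ℕ → ℝ) (m k : ℕ), m ≤ k →
      ∑ j ∈ Finset.range k, f j = ∑ j ∈ Finset.range m, f j + ∑ j ∈ Finset.Ico m k, f j :=
    fun f m k h => (Finset.sum_range_add_sum_Ico f h).symm
  have hs : Summable b := by
    obtain ⟨m, hm⟩ := hbtail 1 one_pos
    refine summable_of_sum_range_le (c := ∑ j ∈ Finset.range m, b j + 1) hb fun k => ?_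
    rcases le_total m k with h | h
    · rw [hsplit b m k h]
      linarith [hm k]
    · have := Finset.sum_le_sum_of_subset_of_nonneg (Finset.range_mono h)
        fun j _ _ => hb j
      linarith
  refine ⟨hs, Metric.tendsto_atTop.2 fun ε hε => ?_⟩
  obtain ⟨m₁, hm₁⟩ := htail (ε / 4) (by positivity)
  obtain ⟨m₂, hm₂⟩ := hbtail (ε / 4) (by positivity)
  have hmono : ∀ (f : ℕ → ℝ), (∀ j, 0 ≤ f j) → ∀ m m' k, m ≤ m' →
      ∑ j ∈ Finset.Ico m' k, f j ≤ ∑ j ∈ Finset.Ico m k, f j := fun f hf m m' k h =>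
    Finset.sum_le_sum_of_subset_of_nonneg (Finset.Ico_subset_Ico_left h) fun j _ _ => hf j
  set m := max m₁ m₂
  have h1 : Tendsto (fun n => ∑ j ∈ Finset.range m, a n j) atTop
      (𝓝 (∑ j ∈ Finset.range m, b j)) := tendsto_finsetSum _ fun j _ => hab j
  have h2 : ∑' j, b j ≤ ∑ j ∈ Finset.range m, b j + ε / 4 := by
    refine le_of_tendsto hs.hasSum.tendsto_sum_nat ?_
    filter_upwards [eventually_ge_atTop m] with k hk
    rw [hsplit b m k hk]
    linarith [hm₂ k, hmono b hb m₂ m k (le_max_right _ _)]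
  have h3 : ∑ j ∈ Finset.range m, b j ≤ ∑' j, b j := hs.sum_le_tsum _ fun j _ => hb j
  refine eventually_atTop.1 ?_
  filter_upwards [Metric.tendsto_nhds.1 h1 (ε / 4) (by positivity),
    hN.eventually (eventually_ge_atTop m)] with n hn hNn
  rw [Real.dist_eq, abs_lt] at hn ⊢
  rw [hsplit (a n) m _ hNn]
  have h4 := hm₁ n (N n)
  have h5 := hmono (a n) (ha n) m₁ m (N n) (le_max_left _ _)
  have h6 : 0 ≤ ∑ j ∈ Finset.Ico m (N n), a n j := Finset.sum_nonneg fun j _ => ha n j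
  constructor <;> linarith [hn.1, hn.2]

/-- A bounded sequence of functions which are Lipschitz up to an error tending to zero has a
pointwise convergent subsequence. -/
theorem exists_subseq_tendsto {X : ℕ → ℝ → ℕ → ℝ} {M : ℝ} {C : ℕ → ℝ} {h : ℕ → ℝ}
    (hX : ∀ n t i, X n t i ∈ Set.Icc 0 M) (hC : ∀ i, 0 ≤ C i) (hh0 : ∀ n, 0 ≤ h n)
    (hh : Tendsto h atTop (𝓝 0))
    (hlip : ∀ n s t i, |X n t i - X n s i| ≤ C i * (|t - s| + h n)) :
    ∃ φ : ℕ → ℕ, StrictMono φ ∧ ∃ ξ : ℕ → ℝ → ℝ,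
      ∀ i t, Tendsto (fun n => X (φ n) t i) atTop (𝓝 (ξ i t)) := by
  -- Tychonoff over the countable set of pairs (index, rational time) replaces an explicit diagonal
  -- extraction.
  obtain ⟨a, -, φ, hφ, ha⟩ := (isCompact_univ_pi
    (fun _ : ℕ × ℚ => isCompact_Icc (a := (0 : ℝ)) (b := M))).tendsto_subseq
    (x := fun n p => X n (p.2 : ℝ) p.1) fun n p _ => hX n _ _
  refine ⟨φ, hφ, ?_⟩
  have key : ∀ i t, ∃ z, Tendsto (fun n => X (φ n) t i) atTop (𝓝 z) := by
    intro i t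
    refine cauchySeq_tendsto_of_complete (Metric.cauchySeq_iff.2 fun ε hε => ?_)
    have hC1 : 0 < C i + 1 := by linarith [hC i]
    -- One δ pays for the distance to a rational time, the other for the Lipschitz defect `h`;
    -- together they cost ε/4.
    set δ := ε / (8 * (C i + 1)) with hδ
    have hδ0 : 0 < δ := by positivity
    have hδε : (C i + 1) * (δ + δ) = ε / 4 := by rw [hδ]; field_simp; norm_num
    obtain ⟨q, hq⟩ := exists_rat_btwn (show t - δ < t by linarith)
    have hq' : |t - q| ≤ δ := by rw [abs_le]; constructor <;> linarith [hq.1, hq.2]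
    have h1 : Tendsto (fun n => X (φ n) q i) atTop (𝓝 (a (i, q))) :=
      (tendsto_pi_nhds.1 ha) (i, q)
    have h2 := (Metric.tendsto_nhds.1 h1 (ε / 4) (by positivity)).and
      ((hh.comp hφ.tendsto_atTop).eventually (gt_mem_nhds hδ0))
    obtain ⟨K, hK⟩ := eventually_atTop.1 h2
    have h3 : ∀ n ≥ K, |X (φ n) t i - a (i, q)| < ε / 2 := by
      intro n hn
      obtain ⟨h4, h5⟩ := hK n hn
      simp only [Function.comp] at h5
      rw [Real.dist_eq] at h4
      have h6 : |X (φ n) t i - X (φ n) q i| ≤ ε / 4 := by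
        refine (hlip (φ n) q t i).trans (hδε ▸ ?_)
        have := hh0 (φ n)
        gcongr
        linarith
      have := abs_sub_le (X (φ n) t i) (X (φ n) q i) (a (i, q))
      linarith
    refine ⟨K, fun m hm n hn => ?_⟩
    rw [Real.dist_eq]
    have h7 := h3 n hn
    rw [abs_sub_comm] at h7
    linarith [h3 m hm, abs_sub_le (X (φ m) t i) (a (i, q)) (X (φ n) t i)]
  choose ξ hξ using key
  exact ⟨ξ, hξ⟩

/-! ### Piecewise constant interpolation in time -/

theorem abs_natFloor_sub_le (a b : ℝ) : |(⌊a⌋₊ : ℝ) - ⌊b⌋₊| ≤ |a - b| + 1 := by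
  have key : ∀ a b : ℝ, (⌊a⌋₊ : ℝ) - ⌊b⌋₊ ≤ |a - b| + 1 := by
    intro a b
    rcases le_total 0 a with ha | ha
    · linarith [Nat.floor_le ha, Nat.lt_floor_add_one b, le_abs_self (a - b)]
    · rw [Nat.floor_of_nonpos ha]
      have : (0 : ℝ) ≤ ⌊b⌋₊ := Nat.cast_nonneg _
      have := abs_nonneg (a - b)
      push_cast
      linarith
  rw [abs_le]
  constructor
  · have := key b a
    rw [abs_sub_comm] at this
    linarith
  · exact key a b

theorem abs_sub_le_of_abs_succ_sub_le {u : ℕ → ℝ} {C : ℝ} (hu : ∀ k, |u (k + 1) - u k| ≤ C)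
    (k l : ℕ) : |u k - u l| ≤ C * |(k : ℝ) - l| := by
  have key : ∀ k d : ℕ, |u (k + d) - u k| ≤ C * d := by
    intro k d
    induction d with
    | zero => simp
    | succ d ih =>
      have := abs_sub_le (u (k + (d + 1))) (u (k + d)) (u k)
      have := hu (k + d)
      push_cast
      rw [← add_assoc] at *
      linarith
  rcases le_total l k with h | h
  · obtain ⟨d, rfl⟩ := Nat.exists_eq_add_of_le h
    simpa using key l d
  · obtain ⟨d, rfl⟩ := Nat.exists_eq_add_of_le h
    rw [abs_sub_comm, abs_sub_comm (k : ℝ)]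
    simpa using key k d

theorem intervalIntegrable_natFloor {f : ℕ → ℝ} {C : ℝ} (hf : ∀ k, |f k| ≤ C) (h a b : ℝ) :
    IntervalIntegrable (fun τ : ℝ => f ⌊τ / h⌋₊) volume a b := by
  have hm : Measurable fun τ : ℝ => f ⌊τ / h⌋₊ :=
    (measurable_from_nat (f := f)).comp (Nat.measurable_floor.comp (measurable_id.div_const h))
  exact (intervalIntegrable_const (c := C)).mono_fun hm.aestronglyMeasurable
    (ae_of_all _ fun τ => (hf _).trans (le_abs_self C))

theorem integral_natFloor {f : ℕ → ℝ} {C : ℝ} (hf : ∀ k, |f k| ≤ C) {h : ℝ} (hh : 0 < h) (k : ℕ) :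
    ∫ τ in (0 : ℝ)..(k * h), f ⌊τ / h⌋₊ = ∑ l ∈ Finset.range k, h * f l := by
  have h1 := intervalIntegral.sum_integral_adjacent_intervals (n := k)
    (a := fun l : ℕ => (l : ℝ) * h) (f := fun τ : ℝ => f ⌊τ / h⌋₊) (μ := volume)
    fun l _ => intervalIntegrable_natFloor hf h _ _
  simp only [Nat.cast_zero, zero_mul] at h1
  rw [← h1]
  refine Finset.sum_congr rfl fun l _ => ?_
  have hle : (l : ℝ) * h ≤ ((l + 1 : ℕ) : ℝ) * h := by
    push_cast
    nlinarith
  have h2 : ∫ τ in ((l : ℝ) * h)..(((l + 1 : ℕ) : ℝ) * h), f ⌊τ / h⌋₊ =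
      ∫ τ in ((l : ℝ) * h)..(((l + 1 : ℕ) : ℝ) * h), f l := by
    -- Open intervals are needed because the floor jumps at the right endpoint.
    rw [intervalIntegral.integral_of_le hle, intervalIntegral.integral_of_le hle,
      integral_Ioc_eq_integral_Ioo, integral_Ioc_eq_integral_Ioo]
    refine setIntegral_congr_fun measurableSet_Ioo fun τ hτ => ?_
    have h3 : ⌊τ / h⌋₊ = l := by
      have h0 : 0 ≤ τ := le_trans (by positivity) hτ.1.le
      rw [Nat.floor_eq_iff (by positivity), le_div_iff₀ hh, div_lt_iff₀ hh]
      exact ⟨hτ.1.le, by exact_mod_cast hτ.2⟩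
    simp only [h3]
  rw [h2, intervalIntegral.integral_const, smul_eq_mul]
  push_cast
  ring

/-- The piecewise constant interpolation of the solution of a recursion `u (k+1) = u k + h * f k`
satisfies the integral equation up to an error of order `h`. -/
theorem abs_sub_integral_natFloor_le {f u : ℕ → ℝ} {C : ℝ} (hf : ∀ k, |f k| ≤ C) {h : ℝ}
    (hh : 0 < h) (hu : ∀ k, u (k + 1) = u k + h * f k) {t : ℝ} (ht : 0 ≤ t) :
    |u ⌊t / h⌋₊ - u 0 - ∫ τ in (0 : ℝ)..t, f ⌊τ / h⌋₊| ≤ C * h := by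
  set k := ⌊t / h⌋₊ with hk
  have hC : 0 ≤ C := (abs_nonneg _).trans (hf 0)
  have h1 : u k = u 0 + ∑ l ∈ Finset.range k, h * f l := by
    have : ∀ k, u k = u 0 + ∑ l ∈ Finset.range k, h * f l := by
      intro k
      induction k with
      | zero => simp
      | succ k ih => rw [Finset.sum_range_succ, hu, ih]; ring
    exact this k
  have h2 : (k : ℝ) * h ≤ t := (le_div_iff₀ hh).1 (Nat.floor_le (by positivity))
  have h3 : t < (k + 1 : ℝ) * h := (div_lt_iff₀ hh).1 (Nat.lt_floor_add_one _)
  have h4 := intervalIntegral.integral_add_adjacent_intervals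
    (intervalIntegrable_natFloor hf h 0 (k * h)) (intervalIntegrable_natFloor hf h (k * h) t)
  rw [h1, ← h4, integral_natFloor hf hh]
  have h5 := intervalIntegral.norm_integral_le_of_norm_le_const (a := k * h) (b := t)
    (f := fun τ : ℝ => f ⌊τ / h⌋₊) fun τ _ => hf _
  rw [Real.norm_eq_abs] at h5
  rw [show u 0 + ∑ l ∈ Finset.range k, h * f l - u 0 - (∑ l ∈ Finset.range k, h * f l +
    ∫ τ in (k * h)..t, f ⌊τ / h⌋₊) = -∫ τ in (k * h)..t, f ⌊τ / h⌋₊ by ring, abs_neg]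
  refine h5.trans ?_
  rw [abs_of_nonneg (by linarith)]
  gcongr
  linarith

/-! ### Convergence of the right-hand side -/

section Limit

variable {γ : ℕ → ℕ → ℝ} {A : ℝ} {p : ℕ → ℕ} {c : ℕ → ℕ → ℕ → ℝ} {x : ℕ → ℕ → ℝ} {y : ℕ → ℝ}

theorem tendsto_growthRate (hp : Tendsto p atTop atTop) (hc : ∀ n, IsCutoffKernel A (p n) (c n))
    (hcγ : ∀ i j, 1 ≤ i → 1 ≤ j → Tendsto (fun n => c n i j) atTop (𝓝 (γ i j)))
    (hx : ∀ n j, 0 ≤ x n j) (hxy : ∀ j, Tendsto (fun n => x n j) atTop (𝓝 (y j))) (i : ℕ) :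
    Tendsto (fun n => growthRate (p n + 1) (c n) (x n) i) atTop
      (𝓝 (y i * ∑ j ∈ Finset.Icc 1 i, (j : ℝ) * γ i j * y j)) := by
  rcases Nat.eq_zero_or_pos i with rfl | hi
  · simp [growthRate_eq_zero (hc _) (Or.inl rfl)]
  refine (hxy i).mul ?_
  have h := (tendsto_sum_of_uniform_tail (N := fun n => p n + 1)
    (a := fun n j => if j ≤ i then (j : ℝ) * c n i j * x n j else 0)
    (b := fun j => if j ∈ Finset.Icc 1 i then (j : ℝ) * γ i j * y j else 0)
    (tendsto_atTop_mono (fun n => Nat.le_succ _) hp) (fun n j => ?_) (fun j => ?_)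
    fun ε hε => ⟨i + 1, fun n k => ?_⟩).2
  · rwa [tsum_eq_sum (s := Finset.Icc 1 i) fun j hj => if_neg hj,
      Finset.sum_congr rfl fun j hj => if_pos hj] at h
  · have := hx n j
    have := (hc n).nonneg i j
    positivity
  · rcases Nat.eq_zero_or_pos j with rfl | hj
    · simp
    · by_cases hji : j ≤ i
      · simp only [hji, if_true, Finset.mem_Icc, Nat.succ_le_of_lt hj, and_self]
        exact ((hcγ i j hi hj).const_mul _).mul (hxy j)
      · simp [hji]
  · rw [Finset.sum_eq_zero fun j hj => ?_]
    · exact hε.le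
    · rw [if_neg]
      have := (Finset.mem_Ico.1 hj).1
      omega

theorem summable_and_tendsto_lossRate (hA : 0 ≤ A) (hp : Tendsto p atTop atTop)
    (hc : ∀ n, IsCutoffKernel A (p n) (c n))
    (hcγ : ∀ i j, 1 ≤ i → 1 ≤ j → Tendsto (fun n => c n i j) atTop (𝓝 (γ i j)))
    (hx : ∀ n j, 0 ≤ x n j) (hxy : ∀ j, Tendsto (fun n => x n j) atTop (𝓝 (y j)))
    (htail : ∀ ε > 0, ∃ m, ∀ n (k : ℕ), ∑ j ∈ Finset.Ico m k, (j : ℝ) * x n j ≤ ε)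
    {i : ℕ} (hi : 1 ≤ i) :
    Summable (fun k : ℕ => γ i (i + k) * y i * y (i + k)) ∧
    Tendsto (fun n => lossRate (p n + 1) (c n) (x n) i) atTop
      (𝓝 (∑' k : ℕ, γ i (i + k) * y i * y (i + k))) := by
  have key := tendsto_sum_of_uniform_tail (N := fun n => p n + 1)
    (a := fun n j => if i ≤ j then c n i j * x n j else 0)
    (b := fun j => if i ≤ j then γ i j * y j else 0)
    (tendsto_atTop_mono (fun n => Nat.le_succ _) hp) (fun n j => ?_) (fun j => ?_)
    (fun ε hε => ?_)
  · obtain ⟨h1, h2⟩ := key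
    have h3 := h1.sum_add_tsum_nat_add i
    rw [Finset.sum_eq_zero fun j hj => if_neg (not_le.2 (Finset.mem_range.1 hj)), zero_add] at h3
    have h4 := (summable_nat_add_iff i).2 h1
    simp only [Nat.le_add_left, if_true] at h3 h4
    have h5 : (fun k : ℕ => γ i (i + k) * y i * y (i + k)) =
        fun k : ℕ => y i * (γ i (k + i) * y (k + i)) := by
      funext k
      rw [add_comm i k]
      ring
    rw [h5, tsum_mul_left, h3]
    exact ⟨h4.mul_left _, (hxy i).mul h2⟩
  · have := mul_nonneg ((hc n).nonneg i j) (hx n j)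
    positivity
  · by_cases hij : i ≤ j
    · simp only [hij, if_true]
      exact (hcγ i j hi (hi.trans hij)).mul (hxy j)
    · simp [hij]
  · obtain ⟨m, hm⟩ := htail (ε / (2 * A + 1)) (by positivity)
    refine ⟨m, fun n k => ?_⟩
    calc _ ≤ ∑ j ∈ Finset.Ico m k, (2 * A + 1) * ((j : ℝ) * x n j) := by
          refine Finset.sum_le_sum fun j _ => ?_
          have := hx n j
          split_ifs with hij
          · have hij' : (i : ℝ) ≤ j := by exact_mod_cast hij
            have h1 : c n i j ≤ (2 * A + 1) * j := by nlinarith [(hc n).le i j]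
            calc c n i j * x n j ≤ ((2 * A + 1) * j) * x n j := by gcongr
              _ = _ := by ring
          · positivity
      _ = (2 * A + 1) * ∑ j ∈ Finset.Ico m k, (j : ℝ) * x n j := by rw [Finset.mul_sum]
      _ ≤ (2 * A + 1) * (ε / (2 * A + 1)) := by gcongr; exact hm n k
      _ = ε := by field_simp

theorem tendsto_flux (hA : 0 ≤ A) (hp : Tendsto p atTop atTop)
    (hc : ∀ n, IsCutoffKernel A (p n) (c n))
    (hcγ : ∀ i j, 1 ≤ i → 1 ≤ j → Tendsto (fun n => c n i j) atTop (𝓝 (γ i j)))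
    (hx : ∀ n j, 0 ≤ x n j) (hxy : ∀ j, Tendsto (fun n => x n j) atTop (𝓝 (y j)))
    (htail : ∀ ε > 0, ∃ m, ∀ n (k : ℕ), ∑ j ∈ Finset.Ico m k, (j : ℝ) * x n j ≤ ε)
    {i : ℕ} (hi : 1 ≤ i) :
    Tendsto (fun n => flux (p n + 1) (c n) (x n) i) atTop (𝓝 (rhs γ y i)) :=
  ((tendsto_growthRate hp hc hcγ hx hxy (i - 1)).sub (tendsto_growthRate hp hc hcγ hx hxy i)).sub
    (summable_and_tendsto_lossRate hA hp hc hcγ hx hxy htail hi).2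

end Limit

/-! ### Truncated data, step size and uniform tails -/

/-- The restriction of a kernel to indices in `[1, n)`. -/
noncomputable def truncKernel (γ : ℕ → ℕ → ℝ) (n i j : ℕ) : ℝ :=
  if (1 ≤ i ∧ i < n) ∧ 1 ≤ j ∧ j < n then γ i j else 0

/-- The restriction of a sequence to indices in `[1, n]`. -/
noncomputable def truncDatum (x : ℕ → ℝ) (n i : ℕ) : ℝ :=
  if 1 ≤ i ∧ i ≤ n then x i else 0

theorem isCutoffKernel_truncKernel {γ : ℕ → ℕ → ℝ} {A : ℝ} (hA : 0 ≤ A)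
    (hγ_nonneg : ∀ i j : ℕ, 1 ≤ i → 1 ≤ j → 0 ≤ γ i j)
    (hγ_symm : ∀ i j : ℕ, 1 ≤ i → 1 ≤ j → γ i j = γ j i)
    (hγ_growth : ∀ i j : ℕ, 1 ≤ i → 1 ≤ j → γ i j ≤ A * ((i : ℝ) + (j : ℝ))) (n : ℕ) :
    IsCutoffKernel A n (truncKernel γ n) where
  nonneg i j := by
    rw [truncKernel]
    split_ifs with h
    · exact hγ_nonneg i j h.1.1 h.2.1
    · exact le_rfl
  symm i j := by
    rw [truncKernel, truncKernel]
    by_cases h : (1 ≤ i ∧ i < n) ∧ 1 ≤ j ∧ j < n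
    · rw [if_pos h, if_pos h.symm, hγ_symm i j h.1.1 h.2.1]
    · rw [if_neg h, if_neg (mt And.symm h)]
  le i j := by
    rw [truncKernel]
    split_ifs with h
    · exact hγ_growth i j h.1.1 h.2.1
    · positivity
  eq_zero i j h := by
    rw [truncKernel, if_neg]
    omega

theorem truncKernel_eq (γ : ℕ → ℕ → ℝ) {n i j : ℕ} (hi : 1 ≤ i) (hj : 1 ≤ j)
    (h : i + j ≤ n) : truncKernel γ n i j = γ i j := by
  rw [truncKernel, if_pos]
  omega

/-- The step size of the Euler scheme for the truncated system. -/
noncomputable def stepSize (A M : ℝ) (n : ℕ) : ℝ := 1 / ((n : ℝ) + 1) / (2 * A * M + 1)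

section StepSize

variable {A M : ℝ}

theorem stepSize_pos (hA : 0 ≤ A) (hM : 0 ≤ M) (n : ℕ) : 0 < stepSize A M n := by
  rw [stepSize]; positivity

theorem stepSize_mul_le (hA : 0 ≤ A) (hM : 0 ≤ M) (n : ℕ) :
    stepSize A M n * (2 * A * (n + 1) * M) ≤ 1 := by
  have h : stepSize A M n * (2 * A * (n + 1) * M) = 2 * A * M / (2 * A * M + 1) := by
    rw [stepSize]
    field_simp
  rw [h, div_le_one (by positivity)]
  linarith

theorem tendsto_stepSize (A M : ℝ) : Tendsto (stepSize A M) atTop (𝓝 0) := by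
  change Tendsto (fun n : ℕ => 1 / ((n : ℝ) + 1) / (2 * A * M + 1)) atTop (𝓝 0)
  simpa using
    (tendsto_one_div_add_atTop_nhds_zero_nat (𝕜 := ℝ)).div_const (2 * A * M + 1)

end StepSize

/-- The piecewise constant approximate solution at level `n`. -/
noncomputable def approx (γ : ℕ → ℕ → ℝ) (A M : ℝ) (x : ℕ → ℝ) (n : ℕ) (t : ℝ) : ℕ → ℝ :=
  eulerSeq (n + 1) (truncKernel γ n) (stepSize A M n) (truncDatum x n) ⌊t / stepSize A M n⌋₊

theorem xiNorm_one {x : ℕ → ℝ} (hx : ∀ i, 1 ≤ i → 0 ≤ x i) :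
    xiNorm 1 x = ∑' i : ℕ, (i : ℝ) * x i ∧
      (x ∈ Xi 1 ↔ Summable fun i : ℕ => (i : ℝ) * x i) := by
  have h : (fun k : ℕ => ((1 + k : ℕ) : ℝ) ^ (1 : ℝ) * |x (1 + k)|) =
      fun k : ℕ => ((k + 1 : ℕ) : ℝ) * x (k + 1) := by
    funext k
    rw [Real.rpow_one, abs_of_nonneg (hx _ (by omega)), add_comm]
  have h1 : x ∈ Xi 1 ↔ Summable fun i : ℕ => (i : ℝ) * x i := by
    rw [Xi, Set.mem_ofPred_eq, h]
    exact summable_nat_add_iff (f := fun i : ℕ => (i : ℝ) * x i) 1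
  refine ⟨?_, h1⟩
  rw [xiNorm, h]
  by_cases hs : Summable fun i : ℕ => (i : ℝ) * x i
  · rw [hs.tsum_eq_zero_add]
    simp
  · rw [tsum_eq_zero_of_not_summable hs, tsum_eq_zero_of_not_summable]
    exact mt (summable_nat_add_iff (f := fun i : ℕ => (i : ℝ) * x i) 1).1 hs

section Approx

variable {x : ℕ → ℝ}

theorem truncDatum_nonneg (hx : ∀ i, 1 ≤ i → 0 ≤ x i) (n i : ℕ) : 0 ≤ truncDatum x n i := by
  rw [truncDatum]
  split_ifs with h
  · exact hx i h.1
  · exact le_rfl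

theorem truncDatum_eq_zero (n i : ℕ) (h : i = 0 ∨ n < i) : truncDatum x n i = 0 := by
  rw [truncDatum, if_neg]
  omega

theorem sum_mul_truncDatum {φ : ℕ → ℝ} (hφ : φ 0 = 0) (n : ℕ) :
    ∑ i ∈ Finset.range (n + 1), φ i * truncDatum x n i =
      ∑ i ∈ Finset.range (n + 1), φ i * x i := by
  refine Finset.sum_congr rfl fun i hi => ?_
  rcases Nat.eq_zero_or_pos i with rfl | h
  · simp [hφ]
  · rw [truncDatum, if_pos ⟨h, Nat.lt_succ_iff.1 (Finset.mem_range.1 hi)⟩]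

theorem sum_mul_truncDatum_le {φ : ℕ → ℝ} (hφ : φ 0 = 0) (hφ0 : ∀ i, 0 ≤ φ i)
    (hx : ∀ i, 1 ≤ i → 0 ≤ x i) (hs : Summable fun i => φ i * x i) (n : ℕ) :
    ∑ i ∈ Finset.range (n + 1), φ i * truncDatum x n i ≤ ∑' i, φ i * x i := by
  rw [sum_mul_truncDatum hφ]
  refine hs.sum_le_tsum _ fun i _ => ?_
  rcases Nat.eq_zero_or_pos i with rfl | h
  · simp [hφ]
  · exact mul_nonneg (hφ0 i) (hx i h)

/-- Beyond m the weight equals the index, so the mass tail is at most the weighted moment, bounded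
by K times a quantity tending to 0; one m then serves all n. -/
theorem uniform_tail_of_tailWeight (hx : ∀ i, 1 ≤ i → 0 ≤ x i)
    (hs : Summable fun i : ℕ => (i : ℝ) * x i) {z : ℕ → ℕ → ℝ} {K : ℝ} {p : ℕ → ℕ}
    (hz : ∀ n i, 0 ≤ z n i) (hz0 : ∀ n i, p n < i → z n i = 0)
    (hK : ∀ m, 0 < m → ∀ n, ∑ i ∈ Finset.range (p n + 1), tailWeight m i * z n i ≤
      K * ∑' i, tailWeight m i * x i) :
    ∀ ε > 0, ∃ m, ∀ n (k : ℕ), ∑ j ∈ Finset.Ico m k, (j : ℝ) * z n j ≤ ε := by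
  intro ε hε
  have h0 : ∀ m, tailWeight m 0 = 0 := fun m => by simp [tailWeight]
  -- The value `x 0` may be negative; zeroing it changes nothing, as the weight vanishes there.
  have h1 := tendsto_tsum_tailWeight (y := fun i => if i = 0 then 0 else x i)
    (fun i => by
      split_ifs with h
      · exact le_rfl
      · exact hx i (by omega))
    (hs.congr fun i => by by_cases h : i = 0 <;> simp [h])
  have h2 : ∀ m, ∑' i, tailWeight m i * (if i = 0 then 0 else x i) =
      ∑' i, tailWeight m i * x i := fun m =>
    tsum_congr fun i => by by_cases h : i = 0 <;> simp [h, h0]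
  simp only [h2] at h1
  have h3 : Tendsto (fun m => K * ∑' i, tailWeight m i * x i) atTop (𝓝 0) := by
    simpa using h1.const_mul K
  obtain ⟨m, hm, hm0⟩ := ((h3.eventually (gt_mem_nhds hε)).and (eventually_gt_atTop 0)).exists
  refine ⟨m, fun n k => ?_⟩
  have hnn : ∀ j, 0 ≤ tailWeight m j * z n j := fun j =>
    mul_nonneg (tailWeight_nonneg m j) (hz n j)
  calc ∑ j ∈ Finset.Ico m k, (j : ℝ) * z n j
      = ∑ j ∈ Finset.Ico m k, tailWeight m j * z n j :=
        Finset.sum_congr rfl fun j hj => by rw [tailWeight_eq hm0 (Finset.mem_Ico.1 hj).1]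
    _ ≤ ∑' j, tailWeight m j * z n j := by
        refine Summable.sum_le_tsum _ (fun j _ => hnn j) ?_
        refine summable_of_ne_finset_zero (s := Finset.range (p n + 1)) fun j hj => ?_
        rw [hz0 n j (by simpa [Nat.lt_succ_iff] using hj), mul_zero]
    _ = ∑ j ∈ Finset.range (p n + 1), tailWeight m j * z n j :=
        tsum_eq_sum fun j hj => by
          rw [hz0 n j (by simpa [Nat.lt_succ_iff] using hj), mul_zero]
    _ ≤ _ := hK m hm0 n
    _ ≤ ε := hm.le

end Approx

/-! ### Construction of the mass-conserving limit -/

theorem exists_massConserving_solution (γ : ℕ → ℕ → ℝ) (A : ℝ) (hA : 0 ≤ A)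
    (hγ_nonneg : ∀ i j : ℕ, 1 ≤ i → 1 ≤ j → 0 ≤ γ i j)
    (hγ_symm : ∀ i j : ℕ, 1 ≤ i → 1 ≤ j → γ i j = γ j i)
    (hγ_growth : ∀ i j : ℕ, 1 ≤ i → 1 ≤ j → γ i j ≤ A * ((i : ℝ) + (j : ℝ)))
    (x : ℕ → ℝ) (hx : ∀ i, 1 ≤ i → 0 ≤ x i) (hs : Summable fun i : ℕ => (i : ℝ) * x i) :
    ∃ ξ : ℕ → ℝ → ℝ, (∀ i t, 0 ≤ ξ i t) ∧ (∀ i, Continuous (ξ i)) ∧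
      (∀ i, 1 ≤ i → ∀ t, Summable fun k : ℕ => γ i (i + k) * ξ i t * ξ (i + k) t) ∧
      (∀ i, 1 ≤ i → ∃ C, ∀ t, ∑' k : ℕ, γ i (i + k) * ξ i t * ξ (i + k) t ≤ C) ∧
      (∀ i, 1 ≤ i → ∀ t, 0 ≤ t →
        ξ i t = x i + ∫ τ in (0 : ℝ)..t, rhs γ (fun j => ξ j τ) i) ∧
      ∀ t, HasSum (fun i : ℕ => (i : ℝ) * ξ i t) (∑' i : ℕ, (i : ℝ) * x i) := by
  set M := ∑' i : ℕ, (i : ℝ) * x i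
  have hM : 0 ≤ M := tsum_nonneg fun i => by
    rcases Nat.eq_zero_or_pos i with rfl | h
    · simp
    · exact mul_nonneg (Nat.cast_nonneg i) (hx i h)
  have hc := isCutoffKernel_truncKernel hA hγ_nonneg hγ_symm hγ_growth
  have hd : ∀ n i, 0 ≤ truncDatum x n i := truncDatum_nonneg hx
  have hd0 : ∀ n i, i = 0 ∨ n < i → truncDatum x n i = 0 := truncDatum_eq_zero
  have hdM : ∀ n, ∑ i ∈ Finset.range (n + 1), (i : ℝ) * truncDatum x n i ≤ M :=
    sum_mul_truncDatum_le (φ := fun i => (i : ℝ)) (by simp) (fun i => Nat.cast_nonneg i) hx hs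
  have hh0 := stepSize_pos hA hM
  have hh := stepSize_mul_le hA hM
  set e := fun n => eulerSeq (n + 1) (truncKernel γ n) (stepSize A M n) (truncDatum x n)
  have he_nonneg : ∀ n k i, 0 ≤ e n k i := fun n k =>
    eulerSeq_nonneg hA (hc n) (hd n) (hdM n) (hh0 n).le (hh n) k
  have he_zero : ∀ n k i, i = 0 ∨ n < i → e n k i = 0 := fun n k =>
    eulerSeq_eq_zero (hc n) (hd0 n) k
  have he_mass : ∀ n k, ∑ i ∈ Finset.range (n + 1), (i : ℝ) * e n k i =
      ∑ i ∈ Finset.range (n + 1), (i : ℝ) * x i := fun n k =>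
    (mass_eulerSeq (hc n) k).trans (sum_mul_truncDatum (φ := fun i => (i : ℝ)) (by simp) n)
  have he_massle : ∀ n k, ∑ i ∈ Finset.range (n + 1), (i : ℝ) * e n k i ≤ M := fun n k =>
    (mass_eulerSeq (hc n) k).trans_le (hdM n)
  have he_le : ∀ n k i, e n k i ≤ M := fun n k =>
    le_mass (he_nonneg n k) (he_zero n k) (he_massle n k)
  set f := fun n k => flux (n + 1) (truncKernel γ n) (e n k)
  set C : ℕ → ℝ := fun i => (4 * i + 2) * A * M ^ 2
  have hC : ∀ i, 0 ≤ C i := fun i => by positivity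
  have hf_le : ∀ n i k, |f n k i| ≤ C i := fun n i k =>
    abs_flux_le hA (hc n) (he_nonneg n k) (he_zero n k) (he_massle n k) i
  have he_succ : ∀ n i k, e n (k + 1) i = e n k i + stepSize A M n * f n k i := fun n i k => rfl
  set X := approx γ A M x
  have hlip : ∀ n s t i, |X n t i - X n s i| ≤ C i * (|t - s| + stepSize A M n) := by
    intro n s t i
    have h1 := abs_sub_le_of_abs_succ_sub_le (u := fun k => e n k i)
      (C := stepSize A M n * C i) (fun k => by
        rw [he_succ, add_sub_cancel_left, abs_mul, abs_of_pos (hh0 n)]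
        exact mul_le_mul_of_nonneg_left (hf_le n i k) (hh0 n).le)
      ⌊t / stepSize A M n⌋₊ ⌊s / stepSize A M n⌋₊
    refine h1.trans ?_
    have h2 := abs_natFloor_sub_le (t / stepSize A M n) (s / stepSize A M n)
    rw [← sub_div, abs_div, abs_of_pos (hh0 n)] at h2
    calc _ ≤ stepSize A M n * C i * (|t - s| / stepSize A M n + 1) :=
          mul_le_mul_of_nonneg_left h2 (mul_nonneg (hh0 n).le (hC i))
      _ = _ := by
          have := (hh0 n).ne'
          field_simp
  obtain ⟨φ, hφ, ξ, hξ⟩ := exists_subseq_tendsto (X := X) (M := M)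
    (fun n t i => ⟨he_nonneg n _ i, he_le n _ i⟩) hC (fun n => (hh0 n).le)
    (tendsto_stepSize A M) hlip
  have hφt : Tendsto φ atTop atTop := hφ.tendsto_atTop
  have hstep : Tendsto (fun n => stepSize A M (φ n)) atTop (𝓝 0) :=
    (tendsto_stepSize A M).comp hφt
  have hcγ : ∀ i j, 1 ≤ i → 1 ≤ j →
      Tendsto (fun n => truncKernel γ (φ n) i j) atTop (𝓝 (γ i j)) := fun i j hi hj =>
    tendsto_const_nhds.congr' <| by
      filter_upwards [hφt.eventually (eventually_ge_atTop (i + j))] with n hn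
      rw [truncKernel_eq γ hi hj hn]
  have hξ_nonneg : ∀ i t, 0 ≤ ξ i t := fun i t =>
    ge_of_tendsto' (hξ i t) fun n => he_nonneg _ _ _
  have hξ_cont : ∀ i, Continuous (ξ i) := fun i => by
    refine (LipschitzWith.of_dist_le_mul (K := ⟨C i, hC i⟩) fun t s => ?_).continuous
    -- The defect `stepSize` disappears in the limit, leaving a genuine Lipschitz bound with
    -- constant `C i`.
    have h1 : Tendsto (fun n => C i * (|t - s| + stepSize A M (φ n))) atTop
        (𝓝 (C i * (|t - s| + 0))) := (hstep.const_add _).const_mul _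
    rw [add_zero] at h1
    rw [Real.dist_eq, Real.dist_eq]
    exact le_of_tendsto_of_tendsto' ((hξ i t).sub (hξ i s)).abs h1 fun n => hlip _ _ _ _
  have htail : ∀ t, ∀ ε > 0, ∃ m, ∀ n (k : ℕ), ∑ j ∈ Finset.Ico m k, (j : ℝ) * X (φ n) t j ≤ ε := by
    intro t
    -- The approximants are defined for all real times and stay at the datum for t ≤ 0, hence `max t
    -- 0`.
    refine uniform_tail_of_tailWeight (p := φ) (K := Real.exp (6 * A * M * max t 0)) hx hs
      (fun n i => he_nonneg _ _ _) (fun n i h => he_zero _ _ _ (Or.inr h)) fun m hm n => ?_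
    refine (moment_eulerSeq_le hA (hc _) (hd _) (hdM _) (hh0 _).le (hh _) (tailWeight_nonneg m)
      (monotone_tailWeight m) (mul_tailWeight_succ_sub_le hm) _).trans ?_
    have hts : Summable fun i => tailWeight m i * x i := by
      refine Summable.of_norm_bounded (g := fun i : ℕ => (i : ℝ) * x i) hs fun i => ?_
      rcases Nat.eq_zero_or_pos i with rfl | h
      · simp [tailWeight]
      · rw [Real.norm_of_nonneg (mul_nonneg (tailWeight_nonneg m i) (hx i h))]
        exact mul_le_mul_of_nonneg_right (tailWeight_le m i) (hx i h)
    have hfl : (⌊t / stepSize A M (φ n)⌋₊ : ℝ) * stepSize A M (φ n) ≤ max t 0 := by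
      rcases le_total 0 t with ht | ht
      · refine le_trans ?_ (le_max_left t 0)
        rw [← le_div_iff₀ (hh0 _)]
        exact Nat.floor_le (div_nonneg ht (hh0 _).le)
      · rw [Nat.floor_of_nonpos (div_nonpos_of_nonpos_of_nonneg ht (hh0 _).le)]
        simp
    have h1 := sum_mul_truncDatum_le (φ := tailWeight m) (by simp [tailWeight])
      (tailWeight_nonneg m) hx hts (φ n)
    have h2 : 0 ≤ ∑ i ∈ Finset.range (φ n + 1), tailWeight m i * truncDatum x (φ n) i :=
      Finset.sum_nonneg fun i _ => mul_nonneg (tailWeight_nonneg m i) (hd _ i)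
    gcongr
  have hloss : ∀ i, 1 ≤ i → ∀ t, _ := fun i hi t =>
    summable_and_tendsto_lossRate (γ := γ) (x := fun n => X (φ n) t) (y := fun j => ξ j t) hA hφt
      (fun n => hc (φ n)) hcγ (fun n i => he_nonneg _ _ _) (fun j => hξ j t) (htail t) hi
  have hflux : ∀ i, 1 ≤ i → ∀ t, _ := fun i hi t =>
    tendsto_flux (γ := γ) (x := fun n => X (φ n) t) (y := fun j => ξ j t) hA hφt
      (fun n => hc (φ n)) hcγ (fun n i => he_nonneg _ _ _) (fun j => hξ j t) (htail t) hi
  refine ⟨ξ, hξ_nonneg, hξ_cont, fun i hi t => (hloss i hi t).1,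
    fun i hi => ⟨M * (2 * A * M), fun t => ?_⟩, fun i hi t ht => ?_, fun t => ?_⟩
  · refine le_of_tendsto' (hloss i hi t).2 fun n => ?_
    obtain ⟨h1, h2⟩ := loss_factor_bounds hA (hc (φ n))
      (he_nonneg (φ n) ⌊t / stepSize A M (φ n)⌋₊) (he_massle _ _) i
    exact mul_le_mul (he_le _ _ _) h2 h1 hM
  · have h1 : Tendsto (fun n => ∫ τ in (0 : ℝ)..t, f (φ n) ⌊τ / stepSize A M (φ n)⌋₊ i) atTop
        (𝓝 (∫ τ in (0 : ℝ)..t, rhs γ (fun j => ξ j τ) i)) := by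
      refine intervalIntegral.tendsto_integral_filter_of_dominated_convergence (fun _ => C i)
        (Eventually.of_forall fun n => ?_)
        (Eventually.of_forall fun n => ae_of_all _ fun τ _ => hf_le _ _ _)
        intervalIntegrable_const (ae_of_all _ fun τ _ => hflux i hi τ)
      rw [Set.uIoc_of_le ht]
      exact (intervalIntegrable_natFloor (f := fun k => f (φ n) k i) (hf_le _ i) _ 0
        t).1.aestronglyMeasurable
    have h2 : Tendsto (fun n => C i * stepSize A M (φ n)) atTop (𝓝 0) := by
      simpa using hstep.const_mul (C i)
    have h3 : Tendsto (fun n => X (φ n) t i - truncDatum x (φ n) i -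
        ∫ τ in (0 : ℝ)..t, f (φ n) ⌊τ / stepSize A M (φ n)⌋₊ i) atTop (𝓝 0) :=
      squeeze_zero_norm (fun n => abs_sub_integral_natFloor_le (u := fun k => e (φ n) k i)
        (f := fun k => f (φ n) k i) (hf_le _ i) (hh0 _) (he_succ _ i) ht) h2
    have h4 : Tendsto (fun n => truncDatum x (φ n) i) atTop (𝓝 (x i)) :=
      tendsto_const_nhds.congr' <| by
        filter_upwards [hφt.eventually (eventually_ge_atTop i)] with n hn
        rw [truncDatum, if_pos ⟨hi, hn⟩]
    -- The Euler residual tends both to 0 and to the residual of the limit equation.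
    have h5 := tendsto_nhds_unique h3 (((hξ i t).sub h4).sub h1)
    linarith
  · obtain ⟨h1, h2⟩ := tendsto_sum_of_uniform_tail (N := fun n => φ n + 1)
      (a := fun n j => (j : ℝ) * X (φ n) t j) (b := fun j => (j : ℝ) * ξ j t)
      (tendsto_atTop_mono (fun n => Nat.le_succ _) hφt)
      (fun n j => mul_nonneg (Nat.cast_nonneg j) (he_nonneg _ _ _))
      (fun j => (hξ j t).const_mul _) (htail t)
    -- Each approximant has exactly the mass of the truncated datum, which tends to M; uniform tails
    -- identify this limit with the mass of `ξ`.
    have h3 : Tendsto (fun n => ∑ j ∈ Finset.range (φ n + 1), (j : ℝ) * X (φ n) t j) atTop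
        (𝓝 M) := by
      have h4 := hs.hasSum.tendsto_sum_nat.comp (tendsto_atTop_mono (fun n => Nat.le_succ _) hφt)
      exact h4.congr fun n => (he_mass (φ n) _).symm
    rw [tendsto_nhds_unique h3 h2]
    exact h1.hasSum

end SafronovDubovskii

/-! ### Measurability, integrability and the norm identity -/

open SafronovDubovskii in
theorem mainTheorem1 (γ : ℕ → ℕ → ℝ) (A : ℝ) (hA : 0 < A)
    (hγ_nonneg : ∀ i j : ℕ, 1 ≤ i → 1 ≤ j → 0 ≤ γ i j)
    (hγ_symm : ∀ i j : ℕ, 1 ≤ i → 1 ≤ j → γ i j = γ j i)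
    (hγ_growth : ∀ i j : ℕ, 1 ≤ i → 1 ≤ j → γ i j ≤ A * ((i : ℝ) + (j : ℝ)))
    (ξin : ℕ → ℝ) (hξin : ξin ∈ SafronovDubovskii.XiPlus 1) :
    ∃ ξ : ℕ → ℝ → ℝ,
      SafronovDubovskii.IsSolution γ ξin ⊤ ξ ∧
      ∀ t : ℝ, 0 ≤ t →
        (fun i => ξ i t) ∈ SafronovDubovskii.XiPlus 1 ∧
        SafronovDubovskii.xiNorm 1 (fun i => ξ i t) = SafronovDubovskii.xiNorm 1 ξin := by
  obtain ⟨hin, hin0⟩ := hξin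
  obtain ⟨hnorm, hmem⟩ := xiNorm_one hin0
  obtain ⟨ξ, h0, hcont, hsum, hbdd, heq, hmass⟩ := exists_massConserving_solution γ A hA.le
    hγ_nonneg hγ_symm hγ_growth ξin hin0 (hmem.1 hin)
  refine ⟨ξ, ⟨fun i _ t _ => h0 i t, fun i _ => (hcont i).continuousOn,
    fun i hi t _ => ae_of_all _ fun τ => hsum i hi τ, fun i hi t _ => ?_,
    fun i hi t ht => heq i hi t ht.1⟩, fun t _ => ?_⟩
  · obtain ⟨C, hC⟩ := hbdd i hi
    have hmeas : Measurable fun τ : ℝ => ∑' k : ℕ, γ i (i + k) * ξ i τ * ξ (i + k) τ := by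
      refine measurable_of_tendsto_metrizable
        (f := fun n τ => ∑ k ∈ Finset.range n, γ i (i + k) * ξ i τ * ξ (i + k) τ) (fun n => ?_)
        (tendsto_pi_nhds.2 fun τ => (hsum i hi τ).hasSum.tendsto_sum_nat)
      exact (continuous_finsetSum _ fun k _ =>
        (continuous_const.mul (hcont i)).mul (hcont (i + k))).measurable
    refine Measure.integrableOn_of_bounded (M := C) measure_Ioo_lt_top.ne
      hmeas.aestronglyMeasurable (ae_of_all _ fun τ => ?_)
    rw [Real.norm_of_nonneg]
    · exact hC τ
    · exact tsum_nonneg fun k => mul_nonneg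
        (mul_nonneg (hγ_nonneg i (i + k) hi (by omega)) (h0 i τ)) (h0 (i + k) τ)
  · obtain ⟨hnorm', hmem'⟩ := xiNorm_one (x := fun i => ξ i t) fun i _ => h0 i t
    refine ⟨⟨hmem'.2 (hmass t).summable, fun i _ => h0 i t⟩, ?_⟩
    rw [hnorm', hnorm, (hmass t).tsum_eq]
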